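/- Let $X$ be a finite list of vectors (sublists are taken with regard to positions, so repeated vectors are distinguished), let $\mathfrak M_X$ be a matroid on $X$ with rank function $rk$ and dual $\mathfrak M_X^*$ with rank function $rk^*$. Let $m:\mathbb P(X)\to\mathbb N\setminus\{0\}$ and put $m^*(A):=m(X\setminus A)$. Assume that $(\mathfrak M_X,m)$ is an arithmetic matroid, i.e. 1. $m(A\cup\{v\})$ divides $m(A)$ whenever $rk(A\cup\{v\})=rk(A)$; 2. $m(A)$ divides $m(A\cup\{v\})$ whenever $rk(A\cup\{v\})=rk(A)+1$; 3. if $B=A\sqcup F\sqcup T$ and $rk(C)=rk(A)+|C\cap F|$ for all $A\subseteq C\subseteq B$, then $m(A)\,m(B)=m(A\cup F)\,m(A\cup T)$; 4. if $A\subseteq B$ and $rk(A)=rk(B)$, then $\sum_{A\subseteq T\subseteq B}(-1)^{|T|-|A|}m(T)\ge 0$; 5. if $A\subseteq B$ and $rk^*(A)=rk^*(B)$, then $\sum_{A\subseteq T\subseteq B}(-1)^{|T|-|A|}m^*(T)\ge 0$. For $S\subseteq X$ put $\mu(S):=\sum_{T\supseteq S}(-1)^{|T|-|S|}m(T)$.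 Let $L_X$ be the list in which each sublist $S$ with $rk(S)=rk(X)$ appears $\mu(S)$ times, and let $\mathcal B$ be the list of pairs $(B,T)$ with $B$ a basis, $T\in L_X$ and $B\subseteq T$, where the copies of $T$ in $L_X$ give different members. Let $\mu^*$, $L_X^*$, $\mathcal B^*$ be defined in the same way from $(\mathfrak M_X^*,m^*)$. Fix any total order on $X$. For a basis $B$, an element $v\in X\setminus B$ is externally active on $B$ if it is dependent on the list of the elements of $B$ that follow it. Let $e(B)$ be the number of these elements, and for $(B,T)\in\mathcal B$ let $e(B,T)$ be the number of them that lie in $T$. Let $e^*$ denote the same statistics for $\mathfrak M_X^*$, $\mathcal B^*$ and the same order. Call $(B,T)$ and $(B,T')$ equivalent if $T$ and $T'$ contain the same externally active elements on $B$, and similarly in $\mathcal B^*$. An *equidistributed matching* is a bijection $\psi:\mathcal B\to\mathcal B^*$ that sends each pair with first entry $B$ to a pair with first entry $B^c=X\setminus B$ and has the following property for every basis $B$. For a class $P$ of pairs in $\mathcal B$ with first entry $B$ and a class $Q$ of pairs in $\mathcal B^*$ with first entry $B^c$, let $|P|,|Q|$ be their numbers of members (with multiplicity), and let $\ell(P,Q)$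 be the number of members of $P$ that $\psi$ sends into $Q$. Then for all such classes $$\frac{\ell(P_1,Q)}{\ell(P_2,Q)}=\frac{|P_1|}{|P_2|},\qquad \frac{\ell(P,Q_1)}{\ell(P,Q_2)}=\frac{|Q_1|}{|Q_2|}$$ (the equalities being read after cross-multiplication). Then: (a) an equidistributed matching exists; (b) for every equidistributed matching $\psi$, the arithmetic Tutte polynomial satisfies $$M_X(x,y):=\sum_{A\subseteq X}m(A)(x-1)^{rk(X)-rk(A)}(y-1)^{|A|-rk(A)}=\sum_{(B,T)\in\mathcal B}x^{e^*(\psi(B,T))}\,y^{e(B,T)};$$ (c) all coefficients of $M_X(x,y)$ are nonnegative; (d) if $m\equiv1$, then $M_X(x,y)$ is the classical Tutte polynomial $T_X(x,y)=\sum_{A\subseteq X}(x-1)^{rk(X)-rk(A)}(y-1)^{|A|-rk(A)}$, each basis $B$ occurs in exactly one member of $\mathcal B$, and for every equidistributed matching $\psi$ every member of $\mathcal B$ and its image under $\psi$ have second entry $X$, with $e(B,X)=e(B)$ and $e^*(\psi(B,X))=e^*(B^c)$. So the formula in (b) becomes Crapo's formula $T_X(x,y)=\sum_{B\text{ basis}}x^{e^*(B^c)}y^{e(B)}$.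 -/

import Mathlib

/-!
Arithmetic matroids, the arithmetic Tutte polynomial, and the data entering its combinatorial
interpretation.

A list of vectors is indexed by a finite type `α` (repeated vectors have different indices), so
that sublists are the terms of `Finset α`. The matroid is a Mathlib matroid on `α` with ground set
everything; loops and parallel elements are allowed.
-/

namespace ArithMatroid

section Basic

variable {α : Type*} [Fintype α] [DecidableEq α]

/-- The rank of a sublist, as a natural number. -/
noncomputable def rk (M : Matroid α) (A : Finset α) : ℕ := (M.eRk (A : Set α)).toNat

/-- `v` is dependent on `A`. -/
def DependentOn (M : Matroid α) (v : α) (A : Finset α) : Prop :=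
  rk M (insert v A) = rk M A

/-- `v` is independent on `A`. -/
def IndependentOn (M : Matroid α) (v : α) (A : Finset α) : Prop :=
  rk M (insert v A) = rk M A + 1

/-- The dual multiplicity function `m*(A) = m(X \ A)`. -/
def dualMult (m : Finset α → ℕ) (A : Finset α) : ℕ := m Aᶜ

/-- `mu m B A` is the alternating sum of `m(T)` over `A ⊆ T ⊆ B`. -/
def mu (m : Finset α → ℕ) (B A : Finset α) : ℤ :=
  ∑ T ∈ Finset.Icc A B, (-1) ^ (T.card - A.card) * (m T : ℤ)

/-- The pair `(M, m)` is an arithmetic matroid on the list of all elements of `α`. -/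
structure IsArithmeticMatroid (M : Matroid α) (m : Finset α → ℕ) : Prop where
  ground_eq : M.E = Set.univ
  pos : ∀ A, 0 < m A
  dvd_of_dependent : ∀ (A : Finset α) (v : α), DependentOn M v A → m (insert v A) ∣ m A
  dvd_of_independent : ∀ (A : Finset α) (v : α), IndependentOn M v A → m A ∣ m (insert v A)
  mul_eq : ∀ A F T : Finset α, Disjoint A F → Disjoint A T → Disjoint F T →
    (∀ C, A ⊆ C → C ⊆ A ∪ F ∪ T → rk M C = rk M A + (C ∩ F).card) →
    m A * m (A ∪ F ∪ T) = m (A ∪ F) * m (A ∪ T)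
  mu_nonneg : ∀ A B : Finset α, A ⊆ B → rk M A = rk M B → 0 ≤ mu m B A
  mu_dual_nonneg : ∀ A B : Finset α, A ⊆ B → rk M.dual A = rk M.dual B →
    0 ≤ mu (dualMult m) B A

/-- The arithmetic Tutte polynomial; the variables `x`, `y` are `X 0`, `X 1`. -/
noncomputable def arithTutte (M : Matroid α) (m : Finset α → ℕ) : MvPolynomial (Fin 2) ℤ :=
  ∑ A : Finset α, (m A : MvPolynomial (Fin 2) ℤ) *
    (MvPolynomial.X 0 - 1) ^ (rk M Finset.univ - rk M A) *
    (MvPolynomial.X 1 - 1) ^ (A.card - rk M A)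

/-- The classical Tutte polynomial. -/
noncomputable def tutte (M : Matroid α) : MvPolynomial (Fin 2) ℤ :=
  ∑ A : Finset α,
    (MvPolynomial.X 0 - 1) ^ (rk M Finset.univ - rk M A) *
    (MvPolynomial.X 1 - 1) ^ (A.card - rk M A)

/-- The list `L_X`: each maximal rank sublist `S` occurs `μ(S)` times. A term is a maximal rank
sublist together with the label of one of its copies. For an arithmetic matroid `μ(S)` is
nonnegative for such `S`, so that `toNat` only changes the type. -/
def FundList (M : Matroid α) (m : Finset α → ℕ) : Type _ :=
  Σ S : {S : Finset α // rk M S = rk M Finset.univ}, Fin (mu m Finset.univ S.1).toNat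

/-- The list `𝓑` of pairs `(B, T)` with `B` a basis, `T` in `L_X` and `B ⊆ T`, in which the copies
of `T` in `L_X` give different members. -/
def PairList (M : Matroid α) (m : Finset α → ℕ) : Type _ :=
  {p : Finset α × FundList M m // M.IsBase (p.1 : Set α) ∧ p.1 ⊆ p.2.1.1}

noncomputable instance (M : Matroid α) (m : Finset α → ℕ) : Fintype (FundList M m) := by
  unfold FundList
  infer_instance

open Classical in
noncomputable instance (M : Matroid α) (m : Finset α → ℕ) : Fintype (PairList M m) := by
  unfold PairList
  infer_instance

/-- The basis `B` of a pair `(B, T)`. -/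
def PairList.basis {M : Matroid α} {m : Finset α → ℕ} (b : PairList M m) : Finset α := b.1.1

/-- The maximal rank sublist `T` of a pair `(B, T)`. -/
def PairList.top {M : Matroid α} {m : Finset α → ℕ} (b : PairList M m) : Finset α := b.1.2.1.1

end Basic

section Ordered

variable {α : Type*} [Fintype α] [LinearOrder α]

/-- The elements that are externally active on `B`: those outside `B` that are dependent on the
list of the elements of `B` following them. -/
noncomputable def extActive (M : Matroid α) (B : Finset α) : Finset α :=
  letI : DecidablePred fun v => DependentOn M v (B.filter (v < ·)) := Classical.decPred _
  (Finset.univ \ B).filter fun v => DependentOn M v (B.filter (v < ·))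

/-- The external activity `e(B)` of `B` in the whole list. -/
noncomputable def extActivity (M : Matroid α) (B : Finset α) : ℕ := (extActive M B).card

/-- The externally active elements on `B` that lie in `T`, for a pair `(B, T)`. Two pairs with the
same basis are identified in the construction of the matching exactly when these agree. -/
noncomputable def PairList.activePart {M : Matroid α} {m : Finset α → ℕ}
    (b : PairList M m) : Finset α := b.top ∩ extActive M b.basis

/-- The local external activity `e(B, T)`. -/
noncomputable def PairList.locActivity {M : Matroid α} {m : Finset α → ℕ}
    (b : PairList M m) : ℕ := b.activePart.card

open Classical in
/-- The number of members of `𝓑` with basis `B` and active part `E`. -/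
noncomputable def classSize (M : Matroid α) (m : Finset α → ℕ) (B E : Finset α) : ℕ :=
  (Finset.univ.filter fun b : PairList M m => b.basis = B ∧ b.activePart = E).card

open Classical in
/-- The number of members of `𝓑` with basis `B` and active part `E` that `ψ` matches with members
of `𝓑*` having active part `E'`. -/
noncomputable def matchCount {M : Matroid α} {m : Finset α → ℕ}
    (ψ : PairList M m ≃ PairList M.dual (dualMult m)) (B E E' : Finset α) : ℕ :=
  (Finset.univ.filter fun b : PairList M m =>
    b.basis = B ∧ b.activePart = E ∧ (ψ b).activePart = E').card

/-- `ψ` is an equidistributed matching between `𝓑` and `𝓑*`: it matches pairs with basis `B` to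
pairs with basis `Bᶜ` and, after the pairs that differ only in nonactive elements are identified,
the copies of each pair are spread evenly over the pairs on the other side, in both directions.
The equalities of ratios are cross-multiplied. -/
structure IsEquidistributed {M : Matroid α} {m : Finset α → ℕ}
    (ψ : PairList M m ≃ PairList M.dual (dualMult m)) : Prop where
  basis_eq : ∀ b, (ψ b).basis = b.basisᶜ
  even : ∀ B : Finset α, M.IsBase (B : Set α) → ∀ E₁ E₂ E' : Finset α,
    matchCount ψ B E₁ E' * classSize M m B E₂ = matchCount ψ B E₂ E' * classSize M m B E₁
  even_dual : ∀ B : Finset α, M.IsBase (B : Set α) → ∀ E E₁' E₂' : Finset α,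
    matchCount ψ B E E₁' * classSize M.dual (dualMult m) Bᶜ E₂' =
      matchCount ψ B E E₂' * classSize M.dual (dualMult m) Bᶜ E₁'

open Classical in
/-- The sum of `x ^ i(B) * y ^ e(B)` over the bases `B`, where the internal activity `i(B)` is the
external activity of the complement of `B` in the dual matroid. -/
noncomputable def crapoSum (M : Matroid α) : MvPolynomial (Fin 2) ℤ :=
  ∑ B ∈ Finset.univ.filter (fun B : Finset α => M.IsBase (B : Set α)),
    MvPolynomial.X 0 ^ extActivity M.dual Bᶜ * MvPolynomial.X 1 ^ extActivity M B

/-- The sum of `x ^ e*(ψ(B, T)) * y ^ e(B, T)` over the members `(B, T)` of `𝓑`. -/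
noncomputable def matchingSum {M : Matroid α} {m : Finset α → ℕ}
    (ψ : PairList M m ≃ PairList M.dual (dualMult m)) : MvPolynomial (Fin 2) ℤ :=
  ∑ b : PairList M m,
    MvPolynomial.X 0 ^ (ψ b).locActivity * MvPolynomial.X 1 ^ b.locActivity

end Ordered

end ArithMatroid

/-!
The proof treats the bases `B` one at a time. Let `E` be the set of externally active elements on
`B`, and let `E*`, a subset of `B`, be the set of externally active elements on `Bᶜ` in the dual
(the internally active elements of `B`).

By Crapo's theorem (`existsUnique_inInterval`) every sublist is `(B \ G) ∪ S` for exactly one basis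
`B` and exactly one pair `S ⊆ E`, `G ⊆ E*`, and then its corank is `|G|` and its nullity `|S|`. The
basis is found greedily: `B ∩ A` consists of the elements of `A` that do not depend on the later
elements of `A`, and `Bᶜ ∩ Aᶜ` has the same description in the dual. Hence the arithmetic Tutte
polynomial is the sum over `B` of the polynomials `∑ m ((B \ G) ∪ S) (x - 1) ^ |G| (y - 1) ^ |S|`.

On the other side, Möbius inversion shows that the classes over `B` with active part above `S`
have `m (B ∪ S)` members in total (`sum_classSize_Icc`), and dually `m (B \ G)` for those over
`Bᶜ`. So the generating polynomials of the class sizes `c` and `c*` are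
`∑ m (B ∪ S) (y - 1) ^ |S|` and `∑ m (B \ G) (x - 1) ^ |G|`, and there are `m B` pairs over `B` as
well as over `Bᶜ`.

The two sides are linked by `extActive_subset_closure`: the elements of `E` depend on `B \ E*`.
Therefore the axiom `mul_eq` applies and gives `m (B \ G) m (B ∪ S) = m B m ((B \ G) ∪ S)`. It follows that
`m B` divides every product of class sizes `c c*`, so that a matching with `c c* / m B` matches
between two classes exists (`exists_equiv_card_eq`); this matching is equidistributed, and
conversely the number of matches in any equidistributed matching is this one. Its generating
polynomial over `B` is the product of the two polynomials above divided by `m B`, which is the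
contribution of `B` to the arithmetic Tutte polynomial.
-/

namespace ArithMatroid

/-! ### Rank, closure and activity -/

section MatroidPart

variable {α : Type*}

lemma eRk_eq_rk (M : Matroid α) (A : Finset α) : M.eRk (A : Set α) = (rk M A : ℕ∞) := by
  unfold rk
  rw [ENat.natCast_toNat]
  rw [Matroid.eRk_ne_top_iff]
  exact M.isRkFinite_of_finite A.finite_toSet

lemma dual_ground {M : Matroid α} (hE : M.E = Set.univ) : M.dual.E = Set.univ := hE

/-- A basis of `A`, together with what a basis of `Aᶜ` in the dual leaves of `Aᶜ`, is a base. -/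
lemma isBase_union_of_isBasis [Finite α] {M : Matroid α} (hE : M.E = Set.univ) {A I J : Set α}
    (hI : M.IsBasis I A) (hJ : M.dual.IsBasis J Aᶜ) : M.IsBase (I ∪ (Aᶜ \ J)) := by
  obtain ⟨B', hB', rfl⟩ := hJ.exists_isBase
  have h1 := hB'.compl_inter_isBasis_of_inter_isBasis hJ
  rw [Matroid.dual_dual] at h1
  have hB := hB'.compl_isBase_of_dual
  have h2 : M.IsBasis (B'ᶜ ∩ A) A := by
    simpa [hE, ← Set.compl_eq_univ_sdiff] using h1
  have h3 : M.IsBase (B'ᶜ) := by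
    simpa [hE, ← Set.compl_eq_univ_sdiff] using hB
  have h4 : Aᶜ \ (B' ∩ Aᶜ) = B'ᶜ \ A := by ext; simp; tauto
  rw [h4]
  have hspan : M.Spanning (I ∪ (B'ᶜ \ A)) := by
    rw [← Matroid.closure_spanning_iff (by simp [hE])]
    refine h3.spanning.superset ?_ (by simp [hE])
    intro x hx
    by_cases hxA : x ∈ A
    · exact M.closure_subset_closure Set.subset_union_left (hI.subset_closure hxA)
    · exact M.mem_closure_of_mem' (Or.inr ⟨hx, hxA⟩) (by simp [hE])
  obtain ⟨B, hB, hBs⟩ := hspan.exists_isBase_subset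
  have : B = I ∪ (B'ᶜ \ A) := by
    refine (Set.toFinite _).eq_of_subset_of_encard_le hBs ?_
    calc (I ∪ (B'ᶜ \ A)).encard ≤ I.encard + (B'ᶜ \ A).encard := Set.encard_union_le _ _
      _ = (B'ᶜ ∩ A).encard + (B'ᶜ \ A).encard := by
        rw [hI.encard_eq_eRk, h2.encard_eq_eRk]
      _ = B'ᶜ.encard := by rw [add_comm, Set.encard_sdiff_add_encard_inter]
      _ = B.encard := by rw [h3.encard_eq_eRank, hB.encard_eq_eRank]
      _ ≤ _ := le_rfl
  exact this ▸ hB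

lemma rk_eq_card_of_isBasis {M : Matroid α} {I A : Finset α} (h : M.IsBasis (I : Set α) A) :
    rk M A = I.card := by
  have h1 := h.eRk_eq_encard
  rw [eRk_eq_rk, Set.encard_coe_eq_coe_finsetCard] at h1
  exact_mod_cast h1

lemma dependentOn_iff [DecidableEq α] {M : Matroid α} (hE : M.E = Set.univ) (v : α) (A : Finset α) :
    DependentOn M v A ↔ v ∈ M.closure (A : Set α) := by
  have h1 := eRk_eq_rk M A
  have h2 := eRk_eq_rk M (insert v A)
  rw [Finset.coe_insert] at h2
  unfold DependentOn
  constructor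
  · intro h
    by_contra hv
    have h3 := Matroid.eRk_insert_eq_add_one (M := M) (e := v) (X := (A : Set α))
      ⟨by simp [hE], hv⟩
    rw [h1, h2, h] at h3
    norm_cast at h3
    omega
  · intro h
    have h3 : M.eRk (insert v (A : Set α)) = M.eRk (A : Set α) := by
      rw [← M.eRk_closure_eq, Matroid.closure_insert_eq_of_mem_closure h, M.eRk_closure_eq]
    rw [h1, h2] at h3
    exact_mod_cast h3

lemma rk_univ_of_isBase [Fintype α] {M : Matroid α} (hE : M.E = Set.univ) {B : Finset α}
    (hB : M.IsBase (B : Set α)) : rk M Finset.univ = B.card := by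
  apply rk_eq_card_of_isBasis
  rw [Finset.coe_univ, ← hE]
  exact hB.isBasis_ground

variable [Fintype α] [LinearOrder α]

lemma mem_extActive_iff {M : Matroid α} (hE : M.E = Set.univ) {B : Finset α} {v : α} :
    v ∈ extActive M B ↔ v ∉ B ∧ v ∈ M.closure {w | w ∈ B ∧ v < w} := by
  unfold extActive
  simp only [Finset.mem_filter, Finset.mem_sdiff, Finset.mem_univ, true_and]
  rw [dependentOn_iff hE]
  simp

lemma isBase_dual_compl {M : Matroid α} (hE : M.E = Set.univ) {B : Finset α} :
    M.dual.IsBase ((Bᶜ : Finset α) : Set α) ↔ M.IsBase (B : Set α) := by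
  rw [Matroid.dual_isBase_iff (by simp [hE]), hE]
  simp

lemma extActive_dual_subset (M : Matroid α) (B : Finset α) :
    extActive M.dual Bᶜ ⊆ B := by
  intro v hv
  unfold extActive at hv
  simp only [Finset.mem_filter, Finset.mem_sdiff, Finset.mem_compl, not_not] at hv
  exact hv.1.2

/-- For a basis `B`, the elements outside `B` that are externally active on `B` depend on what is
left of `B` once the elements that are externally active on `Bᶜ` in the dual are removed: if `u` is
one of these and `v` is externally active, then `u` is not on the fundamental circuit of `v`, as
each would have to precede the other. -/
lemma extActive_subset_closure {M : Matroid α} (hE : M.E = Set.univ) {B : Finset α}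
    (hB : M.IsBase (B : Set α)) {v : α} (hv : v ∈ extActive M B) {G : Finset α}
    (hG : G ⊆ extActive M.dual Bᶜ) : v ∈ M.closure ((B : Set α) \ G) := by
  rw [mem_extActive_iff hE] at hv
  obtain ⟨hvB, hv⟩ := hv
  have key : ∀ u ∈ extActive M.dual Bᶜ, v ∈ M.closure ((B : Set α) \ {u}) := by
    intro u hu
    have hu := (mem_extActive_iff (dual_ground hE)).1 hu
    obtain ⟨huB, hu⟩ := hu
    have huB : u ∈ B := by simpa using huB
    by_cases huv : u ≤ v
    · refine M.closure_subset_closure ?_ hv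
      rintro w ⟨hw, hvw⟩
      exact ⟨hw, fun h => absurd hvw (not_lt.2 ((Set.mem_singleton_iff.1 h).trans_le huv))⟩
    · push Not at huv
      by_contra hcon
      -- Exchanging `u` for `v` gives a spanning set that avoids `u` and the elements of `Bᶜ`
      -- following `u`, so that these are independent in the dual.
      have hspan : M.Spanning (insert v ((B : Set α) \ {u})) := by
        rw [Matroid.spanning_iff_closure_eq (by simp [hE])]
        have hvcl : v ∈ M.closure (insert u ((B : Set α) \ {u})) := by
          rw [Set.insert_sdiff_singleton, Set.insert_eq_of_mem (by simpa using huB),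
            hB.closure_eq, hE]
          trivial
        have := Matroid.closure_insert_congr (M := M) (e := v) (f := u) (X := (B : Set α) \ {u})
          ⟨hvcl, hcon⟩
        rw [this, Set.insert_sdiff_singleton, Set.insert_eq_of_mem (by simpa using huB),
          hB.closure_eq]
      have hdep : ¬ M.dual.Indep (insert u {w | w ∈ Bᶜ ∧ u < w}) := by
        have hI : M.dual.Indep {w | w ∈ Bᶜ ∧ u < w} :=
          ((isBase_dual_compl hE).2 hB).indep.subset (by intro w hw; simpa using hw.1)
        rw [hI.mem_closure_iff_of_notMem (by simp)] at hu
        exact hu.not_indep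
      apply hdep
      rw [← Matroid.coindep_def, Matroid.coindep_iff_compl_spanning (by simp [hE])]
      refine hspan.superset ?_ (by simp [hE])
      rintro w (rfl | ⟨hwB, hwu⟩)
      · refine ⟨by simp [hE], ?_⟩
        rintro (h | ⟨-, h⟩)
        · exact absurd huv (by simp [h])
        · exact absurd huv (not_lt.2 h.le)
      · refine ⟨by simp [hE], ?_⟩
        rintro (h | ⟨h, -⟩)
        · exact hwu h
        · exact (Finset.mem_compl.1 h) hwB
  induction G using Finset.induction_on with
  | empty =>
    refine M.closure_subset_closure ?_ hv
    rintro w ⟨hw, -⟩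
    simpa using hw
  | insert u G _ ih =>
    have h1 := key u (hG (Finset.mem_insert_self u G))
    have h2 := ih ((Finset.subset_insert u G).trans hG)
    have h3 := Matroid.Indep.closure_inter_eq_inter_closure (M := M)
      (I := (B : Set α) \ {u}) (J := (B : Set α) \ G)
      (hB.indep.subset (by rintro w (hw | hw); exacts [hw.1, hw.1]))
    have h4 : v ∈ M.closure ((B : Set α) \ {u} ∩ ((B : Set α) \ G)) := by
      rw [h3]; exact ⟨h1, h2⟩
    refine M.closure_subset_closure ?_ h4
    rintro w ⟨⟨hwB, hwu⟩, -, hwG⟩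
    exact ⟨hwB, by simpa using ⟨hwu, hwG⟩⟩

/-! ### Crapo's partition of the Boolean lattice -/

/-- The elements of `A` that do not depend on the elements of `A` following them. This is the basis
of `A` that the greedy algorithm builds when it starts from the last element. -/
def greedy (M : Matroid α) (A : Set α) : Set α :=
  {a | a ∈ A ∧ a ∉ M.closure {w | w ∈ A ∧ a < w}}

/-- By induction from the last element downwards, an element of `A` depends on the greedy elements
that do not precede it. -/
lemma mem_closure_greedy {M : Matroid α} (hE : M.E = Set.univ) {A : Set α} {a : α} (ha : a ∈ A) :
    a ∈ M.closure {x | x ∈ greedy M A ∧ a ≤ x} := by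
  induction a using WellFoundedGT.induction with
  | ind a ih =>
  by_cases h : a ∈ M.closure {w | w ∈ A ∧ a < w}
  · refine M.closure_subset_closure_of_subset_closure ?_ h
    rintro w ⟨hw, haw⟩
    refine M.closure_subset_closure ?_ (ih w haw hw)
    rintro x ⟨hx, hwx⟩
    exact ⟨hx, haw.le.trans hwx⟩
  · exact M.mem_closure_of_mem' ⟨⟨ha, h⟩, le_rfl⟩ (by simp [hE])

lemma mem_closure_greedy_of_notMem {M : Matroid α} (hE : M.E = Set.univ) {A : Set α} {a : α}
    (ha : a ∈ A) (hag : a ∉ greedy M A) : a ∈ M.closure {x | x ∈ greedy M A ∧ a < x} := by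
  refine M.closure_subset_closure ?_ (mem_closure_greedy hE ha)
  rintro x ⟨hx, hax⟩
  exact ⟨hx, lt_of_le_of_ne hax (by rintro rfl; exact hag hx)⟩

/-- The greedy set is independent because the first element of a circuit depends on the others, all
of which follow it. -/
lemma greedy_isBasis {M : Matroid α} (hE : M.E = Set.univ) (A : Set α) :
    M.IsBasis (greedy M A) A := by
  have hsub : greedy M A ⊆ A := fun a ha => ha.1
  have hcl : A ⊆ M.closure (greedy M A) := fun a ha =>
    M.closure_subset_closure (fun x hx => hx.1) (mem_closure_greedy hE ha)
  have hind : M.Indep (greedy M A) := by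
    rw [Matroid.indep_iff_forall_subset_not_isCircuit (by simp [hE])]
    intro C hC hcirc
    obtain ⟨v, hvC, hv⟩ := Set.exists_min_image C id (Set.toFinite C) hcirc.nonempty
    refine (hC hvC).2 (M.closure_subset_closure ?_ (hcirc.mem_closure_sdiff_singleton_of_mem hvC))
    rintro w ⟨hwC, hwv⟩
    exact ⟨(hC hwC).1, lt_of_le_of_ne (hv w hwC) (fun h => hwv h.symm)⟩
  exact hind.isBasis_of_subset_of_subset_closure hsub hcl

/-- `A` lies in the Boolean interval that Crapo's theorem attaches to `B`: it arises from `B` by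
removing internally active elements and adding externally active ones. -/
def InInterval (M : Matroid α) (B A : Finset α) : Prop :=
  B \ A ⊆ extActive M.dual Bᶜ ∧ A \ B ⊆ extActive M B

/-- Uniqueness in Crapo's theorem: `A` determines `B ∩ A`, and by duality also `Bᶜ ∩ Aᶜ`. -/
lemma InInterval.inter_eq_greedy {M : Matroid α} (hE : M.E = Set.univ) {B A : Finset α}
    (hB : M.IsBase (B : Set α)) (h : InInterval M B A) :
    (B : Set α) ∩ A = greedy M A := by
  have hout : ∀ v ∈ A, v ∉ B → v ∈ M.closure {w | (w ∈ B ∧ w ∈ A) ∧ v < w} := by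
    intro v hvA hvB
    -- `v` depends both on `B ∩ A` and on the part of `B` after `v`; as `B` is independent, it
    -- depends on their intersection.
    have hv := h.2 (Finset.mem_sdiff.2 ⟨hvA, hvB⟩)
    have h1 := extActive_subset_closure hE hB hv h.1
    have h2 := ((mem_extActive_iff hE).1 hv).2
    have h3 := Matroid.Indep.closure_inter_eq_inter_closure (M := M)
      (I := (B : Set α) \ (B \ A : Finset α)) (J := {w | w ∈ B ∧ v < w})
      (hB.indep.subset (by rintro w (hw | hw); exacts [hw.1, hw.1]))
    have h4 : v ∈ M.closure ((B : Set α) \ (B \ A : Finset α) ∩ {w | w ∈ B ∧ v < w}) := by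
      rw [h3]; exact ⟨h1, h2⟩
    refine M.closure_subset_closure ?_ h4
    rintro w ⟨⟨hwB, hw⟩, -, hvw⟩
    simp only [Finset.coe_sdiff, Set.mem_sdiff, Finset.mem_coe, not_and, not_not] at hw hwB
    exact ⟨⟨hwB, hw hwB⟩, hvw⟩
  ext v
  constructor
  · rintro ⟨hvB, hvA⟩
    refine ⟨hvA, fun hv => ?_⟩
    have h1 : v ∈ M.closure {w | (w ∈ B ∧ w ∈ A) ∧ v < w} := by
      refine M.closure_subset_closure_of_subset_closure ?_ hv
      rintro w ⟨hwA, hvw⟩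
      by_cases hwB : w ∈ B
      · exact M.mem_closure_of_mem' ⟨⟨hwB, hwA⟩, hvw⟩ (by simp [hE])
      · refine M.closure_subset_closure ?_ (hout w hwA hwB)
        rintro x ⟨hx, hwx⟩
        exact ⟨hx, lt_trans hvw hwx⟩
    refine hB.indep.notMem_closure_sdiff_of_mem hvB (M.closure_subset_closure ?_ h1)
    rintro x ⟨hx, hvx⟩
    exact ⟨hx.1, fun h => by simp only [Set.mem_singleton_iff] at h; exact absurd hvx (by simp [h])⟩
  · rintro ⟨hvA, hv⟩
    refine ⟨?_, hvA⟩
    by_contra hvB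
    refine hv (M.closure_subset_closure ?_ (hout v hvA hvB))
    rintro x ⟨hx, hvx⟩
    exact ⟨hx.2, hvx⟩

lemma InInterval.dual {M : Matroid α} {B A : Finset α} (h : InInterval M B A) :
    InInterval M.dual Bᶜ Aᶜ := by
  constructor
  · rw [compl_sdiff_compl, Matroid.dual_dual, compl_compl]
    exact h.2
  · rw [compl_sdiff_compl]
    exact h.1

/-- Crapo's theorem: the intervals attached to the bases partition the Boolean lattice. -/
theorem existsUnique_inInterval {M : Matroid α} (hE : M.E = Set.univ) (A : Finset α) :
    ∃! B : Finset α, M.IsBase (B : Set α) ∧ InInterval M B A := by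
  classical
  have hE' := dual_ground hE
  have hI := greedy_isBasis hE (A : Set α)
  have hJ := greedy_isBasis hE' ((A : Set α)ᶜ)
  set I := greedy M (A : Set α) with hIdef
  set J := greedy M.dual ((A : Set α)ᶜ) with hJdef
  have hbase := isBase_union_of_isBasis hE hI hJ
  refine ⟨(I ∪ ((A : Set α)ᶜ \ J)).toFinset, ⟨by simpa using hbase, ?_, ?_⟩, ?_⟩
  · intro u hu
    simp only [Finset.mem_sdiff, Set.mem_toFinset] at hu
    obtain ⟨hu | hu, huA⟩ := hu
    · exact absurd hu.1 huA
    rw [mem_extActive_iff hE']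
    refine ⟨by simp only [Finset.mem_compl, Set.mem_toFinset, not_not]; exact Or.inr hu, ?_⟩
    refine M.dual.closure_subset_closure ?_ (mem_closure_greedy_of_notMem hE' hu.1 hu.2)
    rintro x ⟨hx, hux⟩
    refine ⟨?_, hux⟩
    simp only [Finset.mem_compl, Set.mem_toFinset]
    rintro (h | h)
    · exact hx.1 h.1
    · exact h.2 hx
  · intro v hv
    simp only [Finset.mem_sdiff, Set.mem_toFinset] at hv
    obtain ⟨hvA, hv⟩ := hv
    rw [mem_extActive_iff hE]
    refine ⟨by simpa using hv, ?_⟩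
    refine M.closure_subset_closure ?_
      (mem_closure_greedy_of_notMem hE hvA (fun h => hv (Or.inl h)))
    rintro x ⟨hx, hvx⟩
    exact ⟨by simpa using Or.inl hx, hvx⟩
  · -- A basis `B` as required meets `A` in `I`, and `Bᶜ` meets `Aᶜ` in `J`.
    rintro B ⟨hB, h⟩
    have h1 := h.inter_eq_greedy hE hB
    have h2 := h.dual.inter_eq_greedy hE' ((isBase_dual_compl hE).2 hB)
    rw [Finset.coe_compl A] at h2
    apply Finset.coe_injective
    rw [Set.coe_toFinset, hIdef, hJdef, ← h1, ← h2]
    ext x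
    simp
    tauto

lemma InInterval.rk_eq {M : Matroid α} (hE : M.E = Set.univ) {B A : Finset α}
    (hB : M.IsBase (B : Set α)) (h : InInterval M B A) : rk M A = (B ∩ A).card := by
  apply rk_eq_card_of_isBasis
  rw [Finset.coe_inter, h.inter_eq_greedy hE hB]
  exact greedy_isBasis hE _

lemma disjoint_of_subset_extActive {M : Matroid α} (hE : M.E = Set.univ) {B S : Finset α}
    (hS : S ⊆ extActive M B) : Disjoint S B :=
  Finset.disjoint_left.2 fun _ hv => ((mem_extActive_iff hE).1 (hS hv)).1

lemma sdiff_union_sdiff_eq {M : Matroid α} (hE : M.E = Set.univ) {B S G : Finset α}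
    (hS : S ⊆ extActive M B) : ((B \ G) ∪ S) \ B = S := by
  ext x
  have h1 : x ∈ S → x ∉ B :=
    fun hx => Finset.disjoint_left.1 (disjoint_of_subset_extActive hE hS) hx
  simp
  tauto

lemma sdiff_sdiff_union_eq {M : Matroid α} (hE : M.E = Set.univ) {B S G : Finset α}
    (hS : S ⊆ extActive M B) (hG : G ⊆ extActive M.dual Bᶜ) : B \ ((B \ G) ∪ S) = G := by
  ext x
  have h1 : x ∈ S → x ∉ B :=
    fun hx => Finset.disjoint_left.1 (disjoint_of_subset_extActive hE hS) hx
  have h2 : x ∈ G → x ∈ B := fun hx => extActive_dual_subset M B (hG hx)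
  simp
  tauto

open Classical in
/-- A sum over all sublists, split up according to Crapo's partition. -/
lemma sum_eq_sum_isBase {R : Type*} [AddCommMonoid R] {M : Matroid α} (hE : M.E = Set.univ)
    (w : Finset α → R) :
    ∑ A, w A = ∑ B ∈ Finset.univ.filter (fun B : Finset α => M.IsBase (B : Set α)),
      ∑ S ∈ (extActive M B).powerset, ∑ G ∈ (extActive M.dual Bᶜ).powerset, w ((B \ G) ∪ S) := by
  have h1 : ∀ A : Finset α, w A =
      ∑ B ∈ Finset.univ.filter (fun B : Finset α => M.IsBase (B : Set α)),
        if InInterval M B A then w A else 0 := by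
    intro A
    obtain ⟨B, ⟨hB, h⟩, huniq⟩ := existsUnique_inInterval hE A
    rw [Finset.sum_eq_single_of_mem B (by simpa using hB), if_pos h]
    intro B' hB' hne
    rw [if_neg fun h' => hne (huniq B' ⟨by simpa using hB', h'⟩)]
  rw [Finset.sum_congr rfl fun A _ => h1 A, Finset.sum_comm]
  refine Finset.sum_congr rfl fun B _ => ?_
  rw [← Finset.sum_filter, ← Finset.sum_product']
  have hl : ∀ A : Finset α, (B \ (B \ A)) ∪ (A \ B) = A := by
    intro A; ext x; simp; tauto
  refine Finset.sum_nbij' (fun A => (A \ B, B \ A)) (fun p => (B \ p.2) ∪ p.1) ?_ ?_ ?_ ?_ ?_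
  · intro A hA
    have hA := (Finset.mem_filter.1 hA).2
    exact Finset.mem_product.2 ⟨Finset.mem_powerset.2 hA.2, Finset.mem_powerset.2 hA.1⟩
  · rintro ⟨S, G⟩ hp
    simp only [Finset.mem_product, Finset.mem_powerset] at hp
    refine Finset.mem_filter.2 ⟨Finset.mem_univ _, ?_, ?_⟩
    · rw [sdiff_sdiff_union_eq hE hp.1 hp.2]
      exact hp.2
    · rw [sdiff_union_sdiff_eq hE hp.1]
      exact hp.1
  · intro A _
    exact hl A
  · rintro ⟨S, G⟩ hp
    simp only [Finset.mem_product, Finset.mem_powerset] at hp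
    exact Prod.ext (sdiff_union_sdiff_eq hE hp.1) (sdiff_sdiff_union_eq hE hp.1 hp.2)
  · intro A _
    simp only [hl A]

/-! ### Multiplicities on the blocks of the partition -/

/-- For `B` a basis, the axiom `mul_eq` applies to the removal of dually active and the addition of active
elements: `C ∩ B` is a basis of every `C` between `B \ G` and `B ∪ S`, by `extActive_subset_closure`. -/
lemma IsArithmeticMatroid.mul_eq_of_active {M : Matroid α} {m : Finset α → ℕ}
    (h : IsArithmeticMatroid M m) {B : Finset α} (hB : M.IsBase (B : Set α)) {S G : Finset α}
    (hS : S ⊆ extActive M B) (hG : G ⊆ extActive M.dual Bᶜ) :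
    m (B \ G) * m (B ∪ S) = m B * m ((B \ G) ∪ S) := by
  have hE := h.ground_eq
  have hGB : G ⊆ B := hG.trans (extActive_dual_subset M B)
  have hSB := disjoint_of_subset_extActive hE hS
  have key := h.mul_eq (B \ G) G S Finset.sdiff_disjoint
    (hSB.symm.mono_left Finset.sdiff_subset) (hSB.symm.mono_left hGB) ?_
  · rwa [Finset.sdiff_union_of_subset hGB] at key
  intro C h1 h2
  have hbas : M.IsBasis ((C ∩ B : Finset α) : Set α) C := by
    refine (hB.indep.subset (by simp)).isBasis_of_subset_of_subset_closure (by simp) ?_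
    intro x hx
    by_cases hxB : x ∈ B
    · exact M.mem_closure_of_mem' (by simpa using ⟨hx, hxB⟩) (by simp [hE])
    · have hxS : x ∈ S := by
        have := h2 hx
        rw [Finset.sdiff_union_of_subset hGB, Finset.mem_union] at this
        tauto
      refine M.closure_subset_closure ?_ (extActive_subset_closure hE hB (hS hxS) hG)
      rintro w ⟨hw, hwG⟩
      simpa using ⟨h1 (Finset.mem_sdiff.2 ⟨hw, hwG⟩), hw⟩
  have hbas' : M.IsBasis ((B \ G : Finset α) : Set α) (B \ G : Finset α) :=
    (hB.indep.subset (by simp)).isBasis_self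
  rw [rk_eq_card_of_isBasis hbas, rk_eq_card_of_isBasis hbas', ← Finset.card_union_of_disjoint]
  · congr 1
    ext x
    have h3 := @hGB x
    have h4 := @h1 x
    simp only [Finset.mem_inter, Finset.mem_union, Finset.mem_sdiff] at *
    tauto
  · exact Finset.sdiff_disjoint.mono_right Finset.inter_subset_right

end MatroidPart

/-! ### Möbius inversion over intervals of finite sets -/

section Moebius

lemma sum_Icc_neg_one_pow {α : Type*} [DecidableEq α] [Fintype α] (S U : Finset α) (h : S ⊆ U) :
    ∑ T ∈ Finset.Icc S U, (-1 : ℤ) ^ (T.card - S.card) = if S = U then 1 else 0 := by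
  rw [Finset.Icc_eq_image_powerset h, Finset.sum_image]
  · have h1 : ∀ W ∈ (U \ S).powerset, (-1 : ℤ) ^ ((S ∪ W).card - S.card) = (-1) ^ W.card := by
      intro W hW
      rw [Finset.mem_powerset] at hW
      rw [Finset.card_union_of_disjoint (Finset.disjoint_sdiff.mono_right hW),
        Nat.add_sub_cancel_left]
    rw [Finset.sum_congr rfl h1, Finset.sum_powerset_neg_one_pow_card]
    congr 1
    rw [Finset.sdiff_eq_empty_iff_subset, eq_iff_iff]
    exact ⟨fun h' => h.antisymm h', fun h' => h'.symm.subset⟩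
  · intro W hW W' hW' heq
    have hW : W ⊆ U \ S := Finset.mem_powerset.1 (Finset.mem_coe.1 hW)
    have hW' : W' ⊆ U \ S := Finset.mem_powerset.1 (Finset.mem_coe.1 hW')
    have h1 := Finset.union_sdiff_cancel_left (Finset.disjoint_sdiff.mono_right hW)
    have h2 := Finset.union_sdiff_cancel_left (Finset.disjoint_sdiff.mono_right hW')
    rw [← h1, ← h2]
    exact congrArg (· \ S) heq

/-- Möbius inversion: `m` is recovered by summing `μ` over the larger sets. -/
lemma sum_mu {α : Type*} [DecidableEq α] [Fintype α] (m : Finset α → ℕ) (S : Finset α) :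
    ∑ T ∈ Finset.Icc S Finset.univ, mu m Finset.univ T = m S := by
  unfold mu
  rw [Finset.sum_comm' (t' := Finset.Icc S Finset.univ) (s' := fun U => Finset.Icc S U)]
  · have h1 : ∀ U ∈ Finset.Icc S Finset.univ,
        ∑ T ∈ Finset.Icc S U, (-1 : ℤ) ^ (U.card - T.card) * (m U : ℤ) =
          if S = U then (m U : ℤ) else 0 := by
      intro U hU
      have hSU : S ⊆ U := (Finset.mem_Icc.1 hU).1
      have h2 : ∀ T ∈ Finset.Icc S U, (-1 : ℤ) ^ (U.card - T.card) * (m U : ℤ) =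
          (-1) ^ (U.card - S.card) * m U * (-1) ^ (T.card - S.card) := by
        intro T hT
        rw [Finset.mem_Icc] at hT
        have h3 := Finset.card_le_card hT.1
        have h4 := Finset.card_le_card hT.2
        have h5 : U.card - S.card = (U.card - T.card) + (T.card - S.card) := by omega
        have h6 : (-1 : ℤ) ^ (T.card - S.card) * (-1) ^ (T.card - S.card) = 1 := by
          rw [← mul_pow]; simp
        rw [h5, pow_add]
        linear_combination (-(-1) ^ (U.card - T.card) * (m U : ℤ)) * h6
      rw [Finset.sum_congr rfl h2, ← Finset.mul_sum, sum_Icc_neg_one_pow S U hSU]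
      split_ifs with h
      · simp [h]
      · simp
    rw [Finset.sum_congr rfl h1, Finset.sum_ite_eq]
    simp
  · intro T U
    simp only [Finset.mem_Icc]
    have := Finset.subset_univ T
    have := Finset.subset_univ U
    constructor
    · rintro ⟨⟨h1, -⟩, h2, h3⟩
      exact ⟨⟨h1, h2⟩, h1.trans h2, h3⟩
    · rintro ⟨⟨h1, h2⟩, -, h3⟩
      exact ⟨⟨h1, h2.trans h3⟩, h2, h3⟩

/-- If `f` sums `c` over the sets between its argument and `E`, then the generating polynomial of
`c` in `y` is that of `f` in `y - 1`. -/
lemma sum_mul_pow_card {α R : Type*} [DecidableEq α] [CommRing R] {E : Finset α}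
    {c f : Finset α → ℕ} (h : ∀ S ⊆ E, ∑ T ∈ Finset.Icc S E, c T = f S) (y : R) :
    ∑ T ∈ E.powerset, (c T : R) * y ^ T.card = ∑ S ∈ E.powerset, (f S : R) * (y - 1) ^ S.card := by
  have h1 : ∀ T ∈ E.powerset, (c T : R) * y ^ T.card =
      ∑ S ∈ T.powerset, (c T : R) * (y - 1) ^ S.card := by
    intro T _
    rw [← Finset.mul_sum]
    congr 1
    have := Finset.sum_pow_mul_eq_add_pow (y - 1) 1 T
    simpa using this.symm
  rw [Finset.sum_congr rfl h1,
    Finset.sum_comm' (t' := E.powerset) (s' := fun S => Finset.Icc S E)]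
  · refine Finset.sum_congr rfl fun S hS => ?_
    rw [← Finset.sum_mul, ← h S (Finset.mem_powerset.1 hS)]
    push_cast
    rfl
  · intro T S
    simp only [Finset.mem_powerset, Finset.mem_Icc]
    exact ⟨fun ⟨h1, h2⟩ => ⟨⟨h2, h1⟩, h2.trans h1⟩, fun ⟨⟨h2, h1⟩, _⟩ => ⟨h1, h2⟩⟩

/-- Divisibility passes from the sums `f` over intervals to the summands `c`, by induction from `E`
downwards. -/
lemma dvd_mul_of_sum_Icc {α : Type*} [Finite α] [DecidableEq α] {E : Finset α}
    {c f : Finset α → ℕ} (h : ∀ S ⊆ E, ∑ T ∈ Finset.Icc S E, c T = f S) {d k : ℕ}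
    (hd : ∀ S ⊆ E, d ∣ f S * k) : ∀ S ⊆ E, d ∣ c S * k := by
  intro S
  induction S using WellFoundedGT.induction with
  | ind S ih =>
  intro hS
  have h1 := hd S hS
  rw [← h S hS, Finset.Icc_eq_cons_Ioc hS, Finset.sum_cons, add_mul, Finset.sum_mul] at h1
  refine (Nat.dvd_add_left (Finset.dvd_sum fun T hT => ?_)).1 h1
  rw [Finset.mem_Ioc] at hT
  exact ih T hT.1 hT.2

end Moebius

/-! ### Bijections with prescribed numbers of matches -/

/-- Two finite families over `I` and `J` can be matched bijectively with a prescribed number `n i j`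
of matches between the part over `i` and the part over `j`, when the row and column sums of `n` are
the sizes of the parts. -/
lemma exists_equiv_card_eq {P Q I J : Type*} [Fintype P] [Fintype Q] [Fintype I] [Fintype J]
    [DecidableEq I] [DecidableEq J] (f : P → I) (g : Q → J) (n : I → J → ℕ)
    (hf : ∀ i, ∑ j, n i j = (Finset.univ.filter fun p => f p = i).card)
    (hg : ∀ j, ∑ i, n i j = (Finset.univ.filter fun q => g q = j).card) :
    ∃ e : P ≃ Q, ∀ i j, (Finset.univ.filter fun p => f p = i ∧ g (e p) = j).card = n i j := by
  -- Both families are identified with a disjoint union of sets of `n i j` elements.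
  let Z := Σ ij : I × J, Fin (n ij.1 ij.2)
  have hZ : ∀ p : I × J → Prop, ∀ [DecidablePred p],
      (Finset.univ.filter fun z : Z => p z.1).card =
        ∑ ij ∈ Finset.univ.filter p, n ij.1 ij.2 := by
    intro p _
    have : (Finset.univ.filter fun z : Z => p z.1) =
        (Finset.univ.filter p).sigma fun _ => Finset.univ := by
      ext z
      simp only [Finset.mem_filter, Finset.mem_univ, true_and]
      rw [Finset.mem_sigma]
      simp
    rw [this, Finset.card_sigma]
    simp
  have h1 : ∀ i, Fintype.card {p // f p = i} = Fintype.card {z : Z // z.1.1 = i} := by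
    intro i
    rw [Fintype.card_subtype, Fintype.card_subtype, hZ (fun ij => ij.1 = i), ← hf i,
      Finset.sum_filter, Fintype.sum_prod_type]
    rw [Finset.sum_eq_single_of_mem i (Finset.mem_univ i)]
    · simp
    · intro i' _ hi'
      simp [hi']
  have h2 : ∀ j, Fintype.card {q // g q = j} = Fintype.card {z : Z // z.1.2 = j} := by
    intro j
    rw [Fintype.card_subtype, Fintype.card_subtype, hZ (fun ij => ij.2 = j), ← hg j,
      Finset.sum_filter, Fintype.sum_prod_type]
    simp
  obtain ⟨e1, he1⟩ : ∃ e : P ≃ Z, ∀ p, (e p).1.1 = f p :=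
    ⟨_, Equiv.ofFiberEquiv_map (f := f) (g := fun z : Z => z.1.1)
      fun i => Fintype.equivOfCardEq (h1 i)⟩
  obtain ⟨e2, he2⟩ : ∃ e : Q ≃ Z, ∀ q, (e q).1.2 = g q :=
    ⟨_, Equiv.ofFiberEquiv_map (f := g) (g := fun z : Z => z.1.2)
      fun j => Fintype.equivOfCardEq (h2 j)⟩
  refine ⟨e1.trans e2.symm, fun i j => ?_⟩
  have h3 : (Finset.univ.filter fun p => f p = i ∧ g ((e1.trans e2.symm) p) = j).card =
      (Finset.univ.filter fun z : Z => z.1 = (i, j)).card := by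
    refine Finset.card_equiv e1 fun p => ?_
    simp only [Finset.mem_filter, Finset.mem_univ, true_and, ← he1, ← he2, Equiv.trans_apply,
      Equiv.apply_symm_apply, Prod.ext_iff]
  rw [h3, hZ (fun ij => ij = (i, j))]
  simp [Finset.filter_eq']

/-! ### Sizes of the classes -/

section Counting

variable {α : Type*} [Fintype α]

lemma rk_eq_of_isBase_subset {M : Matroid α} {B T : Finset α} (hE : M.E = Set.univ)
    (hB : M.IsBase (B : Set α)) (hBT : B ⊆ T) : rk M T = rk M Finset.univ := by
  rw [rk_univ_of_isBase hE hB]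
  apply rk_eq_card_of_isBasis
  exact hB.indep.isBasis_of_subset_of_subset_closure (by exact_mod_cast hBT)
    (by rw [hB.closure_eq, hE]; exact Set.subset_univ _)

variable [DecidableEq α]

open Classical in
lemma card_pairs_eq {M : Matroid α} {m : Finset α → ℕ} {B T : Finset α}
    (hB : M.IsBase (B : Set α)) (hBT : B ⊆ T) (hT : rk M T = rk M Finset.univ) :
    (Finset.univ.filter fun b : PairList M m => b.basis = B ∧ b.top = T).card =
      (mu m Finset.univ T).toNat := by
  symm
  rw [← Fintype.card_fin (mu m Finset.univ T).toNat, ← Finset.card_univ]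
  refine Finset.card_bij (fun i _ => ⟨(B, ⟨⟨T, hT⟩, i⟩), hB, hBT⟩) ?_ ?_ ?_
  · intro i _
    exact Finset.mem_filter.2 ⟨Finset.mem_univ _, rfl, rfl⟩
  · intro i _ j _ h
    have h := congrArg (fun b : PairList M m => b.1.2) h
    simpa [FundList] using h
  · rintro ⟨⟨B', ⟨⟨T', hT'⟩, i⟩⟩, hB', hBT'⟩ h
    obtain ⟨-, h1, h2⟩ := Finset.mem_filter.1 h
    change B' = B at h1
    change T' = T at h2
    subst h1 h2
    exact ⟨i, Finset.mem_univ _, rfl⟩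

open Classical in
/-- The sets containing `B` have maximal rank, so that all terms of the Möbius inversion are counted
by the list of pairs. For `S = ∅`, the basis `B` occurs in `m B` pairs. -/
lemma card_pairs_superset {M : Matroid α} {m : Finset α → ℕ} (hE : M.E = Set.univ)
    (hpos : ∀ S, rk M S = rk M Finset.univ → 0 ≤ mu m Finset.univ S) {B : Finset α}
    (hB : M.IsBase (B : Set α)) (S : Finset α) :
    (Finset.univ.filter fun b : PairList M m => b.basis = B ∧ S ⊆ b.top).card = m (B ∪ S) := by
  have h1 : (Finset.univ.filter fun b : PairList M m => b.basis = B ∧ S ⊆ b.top).card =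
      ∑ T ∈ Finset.Icc (B ∪ S) Finset.univ, (mu m Finset.univ T).toNat := by
    rw [Finset.card_eq_sum_card_fiberwise (f := PairList.top)
      (t := Finset.Icc (B ∪ S) Finset.univ)]
    · refine Finset.sum_congr rfl fun T hT => ?_
      have hT := Finset.union_subset_iff.1 (Finset.mem_Icc.1 hT).1
      rw [← card_pairs_eq hB hT.1 (rk_eq_of_isBase_subset hE hB hT.1), Finset.filter_filter]
      congr 1
      refine Finset.filter_congr fun b _ => ?_
      constructor
      · rintro ⟨⟨h1, -⟩, h2⟩
        exact ⟨h1, h2⟩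
      · rintro ⟨h1, h2⟩
        exact ⟨⟨h1, h2 ▸ hT.2⟩, h2⟩
    · intro b hb
      obtain ⟨-, h1, h2⟩ := Finset.mem_filter.1 (Finset.mem_coe.1 hb)
      have h3 : b.basis ⊆ b.top := b.2.2
      exact Finset.mem_coe.2 (Finset.mem_Icc.2
        ⟨Finset.union_subset (h1 ▸ h3) h2, Finset.subset_univ _⟩)
  have h2 := sum_mu m (B ∪ S)
  rw [h1]
  zify
  rw [← h2]
  refine Finset.sum_congr rfl fun T hT => ?_
  have hT := Finset.union_subset_iff.1 (Finset.mem_Icc.1 hT).1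
  exact Int.toNat_of_nonneg (hpos T (rk_eq_of_isBase_subset hE hB hT.1))

end Counting

section ClassSizes

variable {α : Type*} [Fintype α] [LinearOrder α]

/-- The classes with active part above `S` together have `m (B ∪ S)` members. -/
lemma sum_classSize_Icc {M : Matroid α} {m : Finset α → ℕ} (hE : M.E = Set.univ)
    (hpos : ∀ S, rk M S = rk M Finset.univ → 0 ≤ mu m Finset.univ S) {B : Finset α}
    (hB : M.IsBase (B : Set α)) (S : Finset α) (hS : S ⊆ extActive M B) :
    ∑ E ∈ Finset.Icc S (extActive M B), classSize M m B E = m (B ∪ S) := by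
  classical
  rw [← card_pairs_superset hE hpos hB, Finset.card_eq_sum_card_fiberwise
    (f := PairList.activePart) (t := Finset.Icc S (extActive M B))]
  · refine Finset.sum_congr rfl fun E hE' => ?_
    have hE' := Finset.mem_Icc.1 hE'
    rw [Finset.filter_filter]
    unfold classSize
    refine congrArg _ (Finset.filter_congr fun b _ => ?_)
    constructor
    · rintro ⟨h1, h2⟩
      refine ⟨⟨h1, ?_⟩, h2⟩
      exact (h2 ▸ hE'.1).trans Finset.inter_subset_left
    · rintro ⟨⟨h1, -⟩, h2⟩
      exact ⟨h1, h2⟩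
  · intro b hb
    obtain ⟨-, h1, h2⟩ := Finset.mem_filter.1 (Finset.mem_coe.1 hb)
    refine Finset.mem_coe.2 (Finset.mem_Icc.2 ⟨Finset.subset_inter h2 (h1 ▸ hS), ?_⟩)
    exact h1 ▸ Finset.inter_subset_right

lemma classSize_eq_zero {M : Matroid α} {m : Finset α → ℕ} {B E : Finset α}
    (h : ¬ (M.IsBase (B : Set α) ∧ E ⊆ extActive M B)) : classSize M m B E = 0 := by
  unfold classSize
  rw [Finset.card_eq_zero, Finset.filter_eq_empty_iff]
  rintro b - ⟨rfl, rfl⟩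
  exact h ⟨b.2.1, Finset.inter_subset_right⟩

lemma sum_classSize_powerset {M : Matroid α} {m : Finset α → ℕ} {B : Finset α} {R : Type*}
    [CommSemiring R] (w : Finset α → R) :
    ∑ E, (classSize M m B E : R) * w E =
      ∑ E ∈ (extActive M B).powerset, (classSize M m B E : R) * w E := by
  symm
  refine Finset.sum_subset (Finset.subset_univ _) fun E _ h => ?_
  rw [classSize_eq_zero fun h' => h (Finset.mem_powerset.2 h'.2)]
  simp

lemma sum_classSize {M : Matroid α} {m : Finset α → ℕ} (hE : M.E = Set.univ)
    (hpos : ∀ S, rk M S = rk M Finset.univ → 0 ≤ mu m Finset.univ S) {B : Finset α}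
    (hB : M.IsBase (B : Set α)) : ∑ E, classSize M m B E = m B := by
  have h1 := sum_classSize_powerset (M := M) (m := m) (B := B) (R := ℕ) fun _ => 1
  have h2 := sum_classSize_Icc hE hpos hB ∅ (Finset.empty_subset _)
  simp only [Nat.cast_id, mul_one] at h1
  rw [Finset.union_empty] at h2
  rw [h1, ← h2]
  exact Finset.sum_congr (by ext; simp) fun _ _ => rfl

variable {M : Matroid α} {m : Finset α → ℕ}

lemma IsArithmeticMatroid.mu_nonneg_of_rk_eq (h : IsArithmeticMatroid M m) (S : Finset α)
    (hS : rk M S = rk M Finset.univ) : 0 ≤ mu m Finset.univ S :=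
  h.mu_nonneg S _ (Finset.subset_univ S) hS

lemma IsArithmeticMatroid.mu_dual_nonneg_of_rk_eq (h : IsArithmeticMatroid M m) (S : Finset α)
    (hS : rk M.dual S = rk M.dual Finset.univ) : 0 ≤ mu (dualMult m) Finset.univ S :=
  h.mu_dual_nonneg S _ (Finset.subset_univ S) hS

lemma IsArithmeticMatroid.sum_classSize (h : IsArithmeticMatroid M m) {B : Finset α}
    (hB : M.IsBase (B : Set α)) : ∑ E, classSize M m B E = m B :=
  ArithMatroid.sum_classSize h.ground_eq h.mu_nonneg_of_rk_eq hB

lemma IsArithmeticMatroid.sum_classSize_dual (h : IsArithmeticMatroid M m) {B : Finset α}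
    (hB : M.IsBase (B : Set α)) : ∑ E, classSize M.dual (dualMult m) Bᶜ E = m B := by
  rw [ArithMatroid.sum_classSize (dual_ground h.ground_eq) h.mu_dual_nonneg_of_rk_eq
    ((isBase_dual_compl h.ground_eq).2 hB), dualMult, compl_compl]

/-- The number of matches that an even distribution assigns to a pair of classes is an integer. -/
lemma IsArithmeticMatroid.dvd_classSize_mul (h : IsArithmeticMatroid M m) {B : Finset α}
    (hB : M.IsBase (B : Set α)) (E F : Finset α) :
    m B ∣ classSize M m B E * classSize M.dual (dualMult m) Bᶜ F := by
  have hB' := (isBase_dual_compl h.ground_eq).2 hB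
  by_cases hE : E ⊆ extActive M B
  swap
  · rw [classSize_eq_zero fun h' => hE h'.2, zero_mul]; exact dvd_zero _
  by_cases hF : F ⊆ extActive M.dual Bᶜ
  swap
  · rw [classSize_eq_zero (M := M.dual) fun h' => hF h'.2, mul_zero]; exact dvd_zero _
  have h1 := sum_classSize_Icc h.ground_eq h.mu_nonneg_of_rk_eq hB
  have h2 := sum_classSize_Icc (dual_ground h.ground_eq) h.mu_dual_nonneg_of_rk_eq hB'
  -- It suffices to see that `m B` divides `m (B ∪ S) * m (B \ G)` for all `S` and `G`.
  refine dvd_mul_of_sum_Icc h1 (fun S hS => ?_) E hE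
  rw [mul_comm]
  refine dvd_mul_of_sum_Icc h2 (fun G hG => ?_) F hF
  have h3 := h.mul_eq_of_active hB hS hG
  have h4 : (Bᶜ ∪ G)ᶜ = B \ G := by ext; simp
  rw [dualMult, h4, h3]
  exact dvd_mul_right _ _

/-! ### Existence of an equidistributed matching -/

open Classical in
theorem IsArithmeticMatroid.exists_isEquidistributed (h : IsArithmeticMatroid M m) :
    ∃ ψ : PairList M m ≃ PairList M.dual (dualMult m), IsEquidistributed ψ := by
  -- Classes over a basis and over its complement are indexed by that basis and the active part; no
  -- matches are prescribed between different bases. The division is exact by `dvd_classSize_mul`.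
  let n : Finset α × Finset α → Finset α × Finset α → ℕ := fun p q =>
    if p.1 = q.1 then
      classSize M m p.1 p.2 * classSize M.dual (dualMult m) p.1ᶜ q.2 / m p.1 else 0
  have hdual : ∀ B F : Finset α, ¬ M.IsBase (B : Set α) → classSize M.dual (dualMult m) Bᶜ F = 0 := by
    intro B F hB
    exact classSize_eq_zero fun h' => hB ((isBase_dual_compl h.ground_eq).1 h'.1)
  have hrow : ∀ p, ∑ q, n p q = (Finset.univ.filter fun b : PairList M m =>
      (b.basis, b.activePart) = p).card := by
    rintro ⟨B, E⟩
    have h1 : ∑ q, n (B, E) q =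
        ∑ F, classSize M m B E * classSize M.dual (dualMult m) Bᶜ F / m B := by
      rw [Fintype.sum_prod_type, Finset.sum_eq_single_of_mem B (Finset.mem_univ B)]
      · simp [n]
      · intro B' _ hB'
        simp [n, hB'.symm]
    have h2 : (Finset.univ.filter fun b : PairList M m => (b.basis, b.activePart) = (B, E)).card =
        classSize M m B E := by
      unfold classSize
      refine congrArg _ (Finset.filter_congr fun b _ => ?_)
      simp only [Prod.mk.injEq]
    rw [h1, h2]
    by_cases hB : M.IsBase (B : Set α)
    · rw [← Nat.sum_div fun F _ => h.dvd_classSize_mul hB E F, ← Finset.mul_sum,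
        h.sum_classSize_dual hB, Nat.mul_div_cancel _ (h.pos B)]
    · simp [classSize_eq_zero (M := M) (m := m) (B := B) (E := E) fun h' => hB h'.1]
  have hcol : ∀ q, ∑ p, n p q = (Finset.univ.filter fun c : PairList M.dual (dualMult m) =>
      (c.basisᶜ, c.activePart) = q).card := by
    rintro ⟨B, F⟩
    have h1 : ∑ p, n p (B, F) =
        ∑ E, classSize M m B E * classSize M.dual (dualMult m) Bᶜ F / m B := by
      rw [Fintype.sum_prod_type, Finset.sum_eq_single_of_mem B (Finset.mem_univ B)]
      · simp [n]
      · intro B' _ hB'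
        simp [n, hB']
    have h2 : (Finset.univ.filter fun c : PairList M.dual (dualMult m) =>
        (c.basisᶜ, c.activePart) = (B, F)).card = classSize M.dual (dualMult m) Bᶜ F := by
      unfold classSize
      refine congrArg _ (Finset.filter_congr fun b _ => ?_)
      rw [Prod.mk.injEq, compl_eq_comm, eq_comm (a := Bᶜ)]
    rw [h1, h2]
    by_cases hB : M.IsBase (B : Set α)
    · rw [← Nat.sum_div fun E _ => h.dvd_classSize_mul hB E F, ← Finset.sum_mul,
        h.sum_classSize hB, Nat.mul_div_cancel_left _ (h.pos B)]
    · simp [hdual B F hB]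
  obtain ⟨ψ, hψ⟩ := exists_equiv_card_eq
    (fun b : PairList M m => (b.basis, b.activePart))
    (fun c : PairList M.dual (dualMult m) => (c.basisᶜ, c.activePart)) n hrow hcol
  have hbasis : ∀ b, (ψ b).basis = b.basisᶜ := by
    intro b
    by_contra hne
    have h1 := hψ (b.basis, b.activePart) ((ψ b).basisᶜ, (ψ b).activePart)
    have h2 : n (b.basis, b.activePart) ((ψ b).basisᶜ, (ψ b).activePart) = 0 :=
      if_neg fun h' => hne (by rw [show b.basis = _ from h', compl_compl])
    rw [h2, Finset.card_eq_zero, Finset.filter_eq_empty_iff] at h1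
    exact h1 (Finset.mem_univ b) ⟨rfl, rfl⟩
  have hcount : ∀ B : Finset α, M.IsBase (B : Set α) → ∀ E F, m B * matchCount ψ B E F =
      classSize M m B E * classSize M.dual (dualMult m) Bᶜ F := by
    intro B hB E F
    have h1 : matchCount ψ B E F = n (B, E) (B, F) := by
      rw [← hψ]
      unfold matchCount
      refine congrArg _ (Finset.filter_congr fun b _ => ?_)
      simp only [Prod.mk.injEq, hbasis, compl_compl]
      tauto
    rw [h1]
    simp only [n, if_true]
    exact Nat.mul_div_cancel' (h.dvd_classSize_mul hB E F)
  refine ⟨ψ, hbasis, fun B hB E₁ E₂ E' => ?_, fun B hB E E₁' E₂' => ?_⟩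
  · apply Nat.eq_of_mul_eq_mul_left (h.pos B)
    rw [← mul_assoc, ← mul_assoc, hcount B hB, hcount B hB]
    ring
  · apply Nat.eq_of_mul_eq_mul_left (h.pos B)
    rw [← mul_assoc, ← mul_assoc, hcount B hB, hcount B hB]
    ring

end ClassSizes

/-! ### The arithmetic Tutte polynomial -/

section Formula

variable {α : Type*} [Fintype α] [LinearOrder α] {M : Matroid α} {m : Finset α → ℕ}

/-- Evenness over the classes with basis `B` determines all numbers of matches, because the matches
with a given class on the other side add up to the size of that class. -/
lemma IsEquidistributed.mul_matchCount {ψ : PairList M m ≃ PairList M.dual (dualMult m)}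
    (hψ : IsEquidistributed ψ) (h : IsArithmeticMatroid M m) {B : Finset α}
    (hB : M.IsBase (B : Set α)) (E F : Finset α) :
    m B * matchCount ψ B E F = classSize M m B E * classSize M.dual (dualMult m) Bᶜ F := by
  classical
  have h1 : ∑ E', matchCount ψ B E' F = classSize M.dual (dualMult m) Bᶜ F := by
    have h2 : classSize M.dual (dualMult m) Bᶜ F = (Finset.univ.filter fun b : PairList M m =>
        b.basis = B ∧ (ψ b).activePart = F).card := by
      symm
      unfold classSize
      refine Finset.card_equiv ψ fun b => ?_
      simp only [Finset.mem_filter, Finset.mem_univ, true_and, hψ.basis_eq, compl_inj_iff]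
    rw [h2, Finset.card_eq_sum_card_fiberwise (f := PairList.activePart) (t := Finset.univ)
      fun _ _ => Finset.mem_coe.2 (Finset.mem_univ _)]
    refine Finset.sum_congr rfl fun E' _ => ?_
    rw [Finset.filter_filter]
    unfold matchCount
    refine congrArg _ (Finset.filter_congr fun b _ => ?_)
    tauto
  rw [← h.sum_classSize hB, ← h1, mul_comm, Finset.mul_sum, Finset.mul_sum]
  refine Finset.sum_congr rfl fun E' _ => ?_
  rw [hψ.even B hB E E' F, mul_comm]

open Classical in
lemma matchingSum_eq_sum_matchCount (ψ : PairList M m ≃ PairList M.dual (dualMult m)) :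
    matchingSum ψ = ∑ B ∈ Finset.univ.filter (fun B : Finset α => M.IsBase (B : Set α)),
      ∑ E, ∑ F, (matchCount ψ B E F : MvPolynomial (Fin 2) ℤ) *
        (MvPolynomial.X 0 ^ F.card * MvPolynomial.X 1 ^ E.card) := by
  unfold matchingSum
  rw [← Finset.sum_fiberwise_of_maps_to (g := PairList.basis)
    (t := Finset.univ.filter (fun B : Finset α => M.IsBase (B : Set α)))
    fun b _ => Finset.mem_filter.2 ⟨Finset.mem_univ _, b.2.1⟩]
  refine Finset.sum_congr rfl fun B _ => ?_
  rw [← Finset.sum_fiberwise_of_maps_to (g := PairList.activePart) (t := Finset.univ)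
    fun b _ => Finset.mem_univ _]
  refine Finset.sum_congr rfl fun E _ => ?_
  rw [← Finset.sum_fiberwise_of_maps_to (g := fun b => (ψ b).activePart) (t := Finset.univ)
    fun b _ => Finset.mem_univ _]
  refine Finset.sum_congr rfl fun F _ => ?_
  rw [Finset.filter_filter, Finset.filter_filter]
  have h1 : ∀ b ∈ Finset.univ.filter fun b : PairList M m =>
      b.basis = B ∧ b.activePart = E ∧ (ψ b).activePart = F,
      (MvPolynomial.X 0 ^ (ψ b).locActivity * MvPolynomial.X 1 ^ b.locActivity :
        MvPolynomial (Fin 2) ℤ) = MvPolynomial.X 0 ^ F.card * MvPolynomial.X 1 ^ E.card := by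
    intro b hb
    obtain ⟨-, -, h2, h3⟩ := Finset.mem_filter.1 hb
    rw [PairList.locActivity, PairList.locActivity, h2, h3]
  rw [Finset.sum_congr rfl h1, Finset.sum_const, nsmul_eq_mul]
  rfl

lemma InInterval.rk_sub {B A : Finset α} (hE : M.E = Set.univ) (hB : M.IsBase (B : Set α))
    (h : InInterval M B A) : rk M Finset.univ - rk M A = (B \ A).card ∧
      A.card - rk M A = (A \ B).card := by
  rw [h.rk_eq hE hB, rk_univ_of_isBase hE hB, Finset.card_sdiff, Finset.card_sdiff,
    Finset.inter_comm A B]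
  exact ⟨rfl, rfl⟩

open Classical in
/-- The arithmetic Tutte polynomial, summed over the blocks of Crapo's partition. -/
lemma arithTutte_eq_sum_isBase (hE : M.E = Set.univ) (m : Finset α → ℕ) :
    arithTutte M m = ∑ B ∈ Finset.univ.filter (fun B : Finset α => M.IsBase (B : Set α)),
      ∑ S ∈ (extActive M B).powerset, ∑ G ∈ (extActive M.dual Bᶜ).powerset,
        (m ((B \ G) ∪ S) : MvPolynomial (Fin 2) ℤ) * (MvPolynomial.X 0 - 1) ^ G.card *
          (MvPolynomial.X 1 - 1) ^ S.card := by
  unfold arithTutte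
  rw [sum_eq_sum_isBase hE]
  refine Finset.sum_congr rfl fun B hB => Finset.sum_congr rfl fun S hS =>
    Finset.sum_congr rfl fun G hG => ?_
  have hB := (Finset.mem_filter.1 hB).2
  rw [Finset.mem_powerset] at hS hG
  have h1 : ((B \ G) ∪ S) \ B = S := sdiff_union_sdiff_eq hE hS
  have h2 : B \ ((B \ G) ∪ S) = G := sdiff_sdiff_union_eq hE hS hG
  have h3 : InInterval M B ((B \ G) ∪ S) := ⟨by rwa [h2], by rwa [h1]⟩
  rw [(h3.rk_sub hE hB).1, (h3.rk_sub hE hB).2, h1, h2]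

theorem IsEquidistributed.arithTutte_eq {ψ : PairList M m ≃ PairList M.dual (dualMult m)}
    (hψ : IsEquidistributed ψ) (h : IsArithmeticMatroid M m) :
    arithTutte M m = matchingSum ψ := by
  classical
  rw [arithTutte_eq_sum_isBase h.ground_eq, matchingSum_eq_sum_matchCount]
  refine Finset.sum_congr rfl fun B hB => ?_
  have hB := (Finset.mem_filter.1 hB).2
  have hm : (m B : MvPolynomial (Fin 2) ℤ) ≠ 0 := Nat.cast_ne_zero.2 (h.pos B).ne'
  -- After multiplication by `m B`, the contribution of `B` to the matching sum is the product of a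
  -- polynomial in `y` and a polynomial in `x`.
  apply mul_left_cancel₀ hm
  have hB' := (isBase_dual_compl h.ground_eq).2 hB
  have h1 := sum_mul_pow_card (sum_classSize_Icc h.ground_eq h.mu_nonneg_of_rk_eq hB)
    (MvPolynomial.X 1 : MvPolynomial (Fin 2) ℤ)
  have h2 := sum_mul_pow_card (sum_classSize_Icc (dual_ground h.ground_eq)
    h.mu_dual_nonneg_of_rk_eq hB') (MvPolynomial.X 0 : MvPolynomial (Fin 2) ℤ)
  have h3 : (m B : MvPolynomial (Fin 2) ℤ) * ∑ E, ∑ F, (matchCount ψ B E F :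
      MvPolynomial (Fin 2) ℤ) * (MvPolynomial.X 0 ^ F.card * MvPolynomial.X 1 ^ E.card) =
      (∑ E, (classSize M m B E : MvPolynomial (Fin 2) ℤ) * MvPolynomial.X 1 ^ E.card) *
      ∑ F, (classSize M.dual (dualMult m) Bᶜ F : MvPolynomial (Fin 2) ℤ) *
        MvPolynomial.X 0 ^ F.card := by
    rw [Finset.sum_mul_sum, Finset.mul_sum]
    refine Finset.sum_congr rfl fun E _ => ?_
    rw [Finset.mul_sum]
    refine Finset.sum_congr rfl fun F _ => ?_
    have h4 := congrArg (Nat.cast (R := MvPolynomial (Fin 2) ℤ)) (hψ.mul_matchCount h hB E F)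
    push_cast at h4
    rw [← mul_assoc, h4]
    ring
  rw [h3, sum_classSize_powerset, sum_classSize_powerset, h1, h2, Finset.sum_mul_sum,
    Finset.mul_sum]
  refine Finset.sum_congr rfl fun S hS => ?_
  rw [Finset.mul_sum]
  refine Finset.sum_congr rfl fun G hG => ?_
  rw [Finset.mem_powerset] at hS hG
  have h4 := congrArg (Nat.cast (R := MvPolynomial (Fin 2) ℤ)) (h.mul_eq_of_active hB hS hG)
  push_cast at h4
  have h5 : dualMult m (Bᶜ ∪ G) = m (B \ G) := by
    unfold dualMult
    congr 1
    ext; simp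
  rw [h5]
  linear_combination (-(MvPolynomial.X 0 - 1) ^ G.card * (MvPolynomial.X 1 - 1) ^ S.card) * h4

lemma coeff_matchingSum_nonneg (ψ : PairList M m ≃ PairList M.dual (dualMult m))
    (d : Fin 2 →₀ ℕ) : 0 ≤ (matchingSum ψ).coeff d := by
  unfold matchingSum
  rw [MvPolynomial.coeff_sum]
  refine Finset.sum_nonneg fun b _ => ?_
  rw [MvPolynomial.X_pow_eq_monomial, MvPolynomial.X_pow_eq_monomial, MvPolynomial.monomial_mul,
    MvPolynomial.coeff_monomial]
  split_ifs <;> norm_num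

end Formula

/-! ### The trivial multiplicity function -/

section Trivial

lemma mu_of_eq_one {α : Type*} [Fintype α] [DecidableEq α] {m : Finset α → ℕ}
    (hm : ∀ A, m A = 1) (S : Finset α) :
    mu m Finset.univ S = if S = Finset.univ then 1 else 0 := by
  rw [← sum_Icc_neg_one_pow S _ (Finset.subset_univ S)]
  simp [mu, hm]

lemma PairList.top_eq_univ {α : Type*} [Fintype α] [DecidableEq α] {M : Matroid α}
    {m : Finset α → ℕ} (hm : ∀ A, m A = 1) (b : PairList M m) : b.top = Finset.univ := by
  by_contra h
  -- The label of the copy of `b.top` would lie in `Fin 0`.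
  have h1 : mu m Finset.univ b.top = 0 := by rw [mu_of_eq_one hm, if_neg h]
  have h2 : (mu m Finset.univ b.top).toNat = 0 := by rw [h1]; rfl
  exact (Fin.cast h2 b.1.2.2).elim0

variable {α : Type*} [Fintype α] [LinearOrder α] {M : Matroid α} {m : Finset α → ℕ}

/-- For `m = 1` the function `μ` is supported at the whole list, with value `1`, so that the pair is
that of `B` with the only copy of the whole list. -/
lemma existsUnique_pair (hm : ∀ A, m A = 1) {B : Finset α} (hB : M.IsBase (B : Set α)) :
    ∃! b : PairList M m, b.basis = B := by
  classical
  have h1 := card_pairs_eq (m := m) hB (Finset.subset_univ B) rfl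
  rw [mu_of_eq_one hm, if_pos rfl, Int.toNat_one, Finset.card_eq_one] at h1
  obtain ⟨b, hb⟩ := h1
  have h2 : ∀ c : PairList M m, c.basis = B ↔ c = b := by
    intro c
    have h3 : c ∈ Finset.univ.filter (fun b : PairList M m => b.basis = B ∧ b.top = Finset.univ) ↔
        c = b := by rw [hb, Finset.mem_singleton]
    simpa [PairList.top_eq_univ hm] using h3
  exact ⟨b, (h2 b).2 rfl, fun c hc => (h2 c).1 hc⟩

lemma PairList.locActivity_eq (hm : ∀ A, m A = 1) (b : PairList M m) :
    b.locActivity = extActivity M b.basis := by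
  rw [PairList.locActivity, PairList.activePart, b.top_eq_univ hm, Finset.univ_inter, extActivity]

lemma dualMult_eq_one (hm : ∀ A, m A = 1) (A : Finset α) : dualMult m A = 1 := hm _

lemma IsEquidistributed.matchingSum_eq_crapoSum
    {ψ : PairList M m ≃ PairList M.dual (dualMult m)} (hψ : IsEquidistributed ψ)
    (hm : ∀ A, m A = 1) : matchingSum ψ = crapoSum M := by
  classical
  unfold matchingSum crapoSum
  refine Finset.sum_bij (fun b _ => b.basis) ?_ ?_ ?_ ?_
  · exact fun b _ => Finset.mem_filter.2 ⟨Finset.mem_univ _, b.2.1⟩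
  · exact fun b _ c _ h => (existsUnique_pair hm b.2.1).unique rfl h.symm
  · intro B hB
    obtain ⟨b, hb, -⟩ := existsUnique_pair hm (Finset.mem_filter.1 hB).2
    exact ⟨b, Finset.mem_univ b, hb⟩
  · intro b _
    rw [b.locActivity_eq hm, (ψ b).locActivity_eq (dualMult_eq_one hm), hψ.basis_eq]

end Trivial

end ArithMatroid

theorem theorem7p3 {α : Type*} [Fintype α] [LinearOrder α]
    (M : Matroid α) (m : Finset α → ℕ) (h : ArithMatroid.IsArithmeticMatroid M m) :
    -- an equidistributed matching exists
    (∃ ψ : ArithMatroid.PairList M m ≃ ArithMatroid.PairList M.dual (ArithMatroid.dualMult m),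
      ArithMatroid.IsEquidistributed ψ) ∧
    -- the formula, for every such matching
    (∀ ψ : ArithMatroid.PairList M m ≃ ArithMatroid.PairList M.dual (ArithMatroid.dualMult m),
      ArithMatroid.IsEquidistributed ψ →
        ArithMatroid.arithTutte M m = ArithMatroid.matchingSum ψ) ∧
    -- nonnegativity of the coefficients
    (∀ d : Fin 2 →₀ ℕ, 0 ≤ (ArithMatroid.arithTutte M m).coeff d) ∧
    -- for the trivial multiplicity function, the formula is Crapo's formula, term by term
    ((∀ A, m A = 1) →
      ArithMatroid.arithTutte M m = ArithMatroid.tutte M ∧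
      (∀ B : Finset α, M.IsBase (B : Set α) →
        ∃! b : ArithMatroid.PairList M m, b.basis = B) ∧
      (∀ ψ : ArithMatroid.PairList M m ≃ ArithMatroid.PairList M.dual (ArithMatroid.dualMult m),
        ArithMatroid.IsEquidistributed ψ →
          (∀ b : ArithMatroid.PairList M m,
            b.top = Finset.univ ∧ (ψ b).top = Finset.univ ∧
            b.locActivity = ArithMatroid.extActivity M b.basis ∧
            (ψ b).locActivity = ArithMatroid.extActivity M.dual b.basisᶜ) ∧
          ArithMatroid.matchingSum ψ = ArithMatroid.crapoSum M) ∧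
      ArithMatroid.tutte M = ArithMatroid.crapoSum M) := by
  obtain ⟨ψ₀, hψ₀⟩ := h.exists_isEquidistributed
  refine ⟨⟨ψ₀, hψ₀⟩, fun ψ hψ => hψ.arithTutte_eq h, fun d => ?_, fun hm => ?_⟩
  · rw [hψ₀.arithTutte_eq h]
    exact ArithMatroid.coeff_matchingSum_nonneg ψ₀ d
  have hT : ArithMatroid.arithTutte M m = ArithMatroid.tutte M := by
    simp [ArithMatroid.arithTutte, ArithMatroid.tutte, hm]
  refine ⟨hT, fun B hB => ArithMatroid.existsUnique_pair hm hB, fun ψ hψ => ⟨fun b => ?_,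
    hψ.matchingSum_eq_crapoSum hm⟩, ?_⟩
  · refine ⟨b.top_eq_univ hm, (ψ b).top_eq_univ (ArithMatroid.dualMult_eq_one hm),
      b.locActivity_eq hm, ?_⟩
    rw [(ψ b).locActivity_eq (ArithMatroid.dualMult_eq_one hm), hψ.basis_eq]
  · rw [← hT, hψ₀.arithTutte_eq h, hψ₀.matchingSum_eq_crapoSum hm]
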